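/- Let $\Gamma=(X,R)$ be a finite bipartite distance-regular graph with path-length distance $\partial$, diameter $D\ge 4$, valency $k\ge 3$ and intersection numbers $p^h_{ij}$ (for $\partial(x,y)=h$, the number of $z\in X$ with $\partial(x,z)=i$ and $\partial(z,y)=j$); write $b_i=p^i_{1,i+1}$ and $d=\lfloor D/2\rfloor$. For $0\le i\le D$ let $A_i\in \mathrm{Mat}_X(\mathbb C)$ be the $i$-th distance matrix, with $(y,z)$-entry $1$ if $\partial(y,z)=i$ and $0$ otherwise. Let $A=A_1$ be the adjacency matrix, $M$ the subalgebra of $\mathrm{Mat}_X(\mathbb C)$ generated by $A$, $\theta_0>\theta_1>\cdots>\theta_D$ the distinct eigenvalues of $A$, and $E_i$ the orthogonal projection of $\mathbb C^X$ onto the eigenspace of $A$ for $\theta_i$. Fix $x\in X$. For $0\le i\le D$ let $E_i^*$ be the diagonal matrix with $(y,y)$-entry $1$ if $\partial(x,y)=i$ and $0$ otherwise, and let $T$ be the subalgebra of $\mathrm{Mat}_X(\mathbb C)$ generated by $M$ and $E_0^*,\dots,E_D^*$. A $T$-module is a $T$-invariant subspace of $\mathbb C^X$; it is irreducible if it is nonzero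 and contains no $T$-modules other than $0$ and itself. An irreducible $T$-module $W$ is thin if $\dim E_i^*W\le 1$ for $0\le i\le D$, and its endpoint is $\min\{i : 0\le i\le D,\ E_i^*W\neq 0\}$. If $W$ is thin and irreducible with endpoint $2$, then the one-dimensional space $E_2^*W$ is spanned by an eigenvector of $E_2^*A_2E_2^*$, and the corresponding eigenvalue is called the local eigenvalue of $W$. Let $n\in\{1,d\}$ if $D$ is odd, and let $n=1$ if $D$ is even. Put $$\tilde\theta_n=-1-\frac{b_2b_3}{\theta_n^2-b_2},$$ where the denominator is nonzero because $\theta_1^2>b_2>\theta_d^2$. **Theorem.** Let $W$ be a thin irreducible $T$-module with endpoint $2$ and local eigenvalue $\tilde\theta_n$, and let $v$ be a nonzero vector in $E_2^*W$. Then $W=Mv$. Moreover, the vectors $$E_iv\qquad(1\le i\le D-1,\ i\ne n,\ i\ne D-n)$$ form a basis of $W$, and $E_0v=0$, $E_nv=0$, $E_{D-n}v=0$, $E_Dv=0$. -/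

import Mathlib

open scoped Matrix

namespace DRG

noncomputable section

/-- A finite graph is distance-regular if it is connected and, for all `h, i, j` between `0` and
the diameter, the number of `z` with `∂(x,z) = i` and `∂(z,y) = j` is the same for all pairs `x, y`
at distance `h`. -/
def IsDistanceRegular {X : Type*} [Fintype X] (G : SimpleGraph X) : Prop :=
  G.Connected ∧ ∀ h i j : ℕ, h ≤ G.diam → i ≤ G.diam → j ≤ G.diam →
    ∃ p : ℕ, ∀ x y : X, G.dist x y = h →
      (Finset.univ.filter fun z : X => G.dist x z = i ∧ G.dist z y = j).card = p

/-- The intersection number `p^h_{ij}`: the maximum, over the pairs `x, y` at distance `h`, of the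
number of `z` with `∂(x,z) = i` and `∂(z,y) = j`. In a distance-regular graph it is the common
value of all these numbers. -/
def intersectionNumber {X : Type*} [Fintype X] (G : SimpleGraph X) (h i j : ℕ) : ℕ :=
  (Finset.univ.filter fun q : X × X => G.dist q.1 q.2 = h).sup fun q =>
    (Finset.univ.filter fun z : X => G.dist q.1 z = i ∧ G.dist z q.2 = j).card

/-- The intersection number `b_i = p^i_{1,i+1}`. -/
def b {X : Type*} [Fintype X] (G : SimpleGraph X) (i : ℕ) : ℕ :=
  intersectionNumber G i 1 (i + 1)

/-- The `i`-th distance matrix `A_i`. -/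
def distMatrix {X : Type*} (G : SimpleGraph X) (i : ℕ) : Matrix X X ℂ :=
  Matrix.of fun y z => if G.dist y z = i then 1 else 0

/-- The adjacency matrix `A = A_1`. -/
def adjacency {X : Type*} (G : SimpleGraph X) : Matrix X X ℂ :=
  distMatrix G 1

/-- The finite set of the real eigenvalues of `A`. Since `A` is real symmetric, these are all its
eigenvalues. -/
def eigenvalueSet {X : Type*} [Fintype X] [DecidableEq X] (G : SimpleGraph X) : Finset ℝ :=
  Set.Finite.toFinset (s := {t : ℝ |
      Module.End.HasEigenvalue (Matrix.toLin' (adjacency G)) (t : ℂ)})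
    (Set.Finite.preimage Complex.ofReal_injective.injOn
      (Module.End.finite_hasEigenvalue (Matrix.toLin' (adjacency G))))

/-- `θ_i`: the `i`-th entry (from `i = 0`) of the list of the distinct eigenvalues of `A` in
decreasing order. A distance-regular graph of diameter `D` has exactly `D + 1` of them; the value
past the end of the list is irrelevant. -/
def eigenvalue {X : Type*} [Fintype X] [DecidableEq X] (G : SimpleGraph X) (i : ℕ) : ℝ :=
  ((eigenvalueSet G).sort (· ≥ ·)).getD i 0

/-- The primitive idempotent `E_i`: the matrix of the orthogonal projection of the Hermitian space
`ℂ^X` onto the eigenspace of `A` for `θ_i`. -/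
def primitiveIdempotent {X : Type*} [Fintype X] [DecidableEq X] (G : SimpleGraph X) (i : ℕ) :
    Matrix X X ℂ :=
  Matrix.toEuclideanLin.symm
    ((Module.End.eigenspace (Matrix.toEuclideanLin (adjacency G))
      (eigenvalue G i : ℂ)).starProjection : EuclideanSpace ℂ X →ₗ[ℂ] EuclideanSpace ℂ X)

/-- The `i`-th dual idempotent `E*_i = E*_i(x)`. -/
def dualIdempotent {X : Type*} [DecidableEq X] (G : SimpleGraph X) (x : X) (i : ℕ) :
    Matrix X X ℂ :=
  Matrix.diagonal fun y => if G.dist x y = i then 1 else 0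

/-- The Bose-Mesner algebra `M`, generated by `A`. -/
def boseMesner {X : Type*} [Fintype X] [DecidableEq X] (G : SimpleGraph X) :
    Subalgebra ℂ (Matrix X X ℂ) :=
  Algebra.adjoin ℂ {adjacency G}

/-- The dual Bose-Mesner algebra `M* = M*(x)`, generated by the dual idempotents
(`E*_i = 0` for `i > D`). -/
def dualBoseMesner {X : Type*} [Fintype X] [DecidableEq X] (G : SimpleGraph X) (x : X) :
    Subalgebra ℂ (Matrix X X ℂ) :=
  Algebra.adjoin ℂ (Set.range (dualIdempotent G x))

/-- The subconstituent (Terwilliger) algebra `T = T(x)`, generated by `M` and `M*`. -/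
def subconstituentAlgebra {X : Type*} [Fintype X] [DecidableEq X] (G : SimpleGraph X) (x : X) :
    Subalgebra ℂ (Matrix X X ℂ) :=
  boseMesner G ⊔ dualBoseMesner G x

/-- A `T`-module: a subspace of `ℂ^X` invariant under `T`. -/
def IsTModule {X : Type*} [Fintype X] [DecidableEq X] (G : SimpleGraph X) (x : X)
    (W : Submodule ℂ (X → ℂ)) : Prop :=
  ∀ B ∈ subconstituentAlgebra G x, ∀ w ∈ W, B *ᵥ w ∈ W

/-- An irreducible `T`-module. -/
def IsIrreducibleTModule {X : Type*} [Fintype X] [DecidableEq X] (G : SimpleGraph X) (x : X)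
    (W : Submodule ℂ (X → ℂ)) : Prop :=
  IsTModule G x W ∧ W ≠ ⊥ ∧
    ∀ W' : Submodule ℂ (X → ℂ), IsTModule G x W' → W' ≤ W → W' = ⊥ ∨ W' = W

/-- The subspace `E*_i W`. -/
def dualComponent {X : Type*} [Fintype X] [DecidableEq X] (G : SimpleGraph X) (x : X) (i : ℕ)
    (W : Submodule ℂ (X → ℂ)) : Submodule ℂ (X → ℂ) :=
  W.map (Matrix.mulVecLin (dualIdempotent G x i))

/-- `W` is thin: `dim E*_i W ≤ 1` for `0 ≤ i ≤ D`. -/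
def IsThin {X : Type*} [Fintype X] [DecidableEq X] (G : SimpleGraph X) (x : X)
    (W : Submodule ℂ (X → ℂ)) : Prop :=
  ∀ i ≤ G.diam, Module.finrank ℂ (dualComponent G x i W) ≤ 1

/-- The endpoint of `W`: the least `i` with `0 ≤ i ≤ D` and `E*_i W ≠ 0`. -/
def endpoint {X : Type*} [Fintype X] [DecidableEq X] (G : SimpleGraph X) (x : X)
    (W : Submodule ℂ (X → ℂ)) : ℕ :=
  sInf {i : ℕ | i ≤ G.diam ∧ dualComponent G x i W ≠ ⊥}

/-- `η` is the local eigenvalue of `W`: the space `E*_2 W` is nonzero and consists of eigenvectors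
(and `0`) of `E*_2 A_2 E*_2` with eigenvalue `η`. -/
def HasLocalEigenvalue {X : Type*} [Fintype X] [DecidableEq X] (G : SimpleGraph X) (x : X)
    (W : Submodule ℂ (X → ℂ)) (η : ℝ) : Prop :=
  dualComponent G x 2 W ≠ ⊥ ∧
    ∀ w ∈ dualComponent G x 2 W,
      (dualIdempotent G x 2 * distMatrix G 2 * dualIdempotent G x 2) *ᵥ w = (η : ℂ) • w

/-- The scalar `-1 - b_2 b_3 / (z ^ 2 - b_2)`, for real `z` with `z ^ 2 ≠ b_2`. In a bipartite
distance-regular graph with `D ≥ 4` and `k ≥ 3` one has `θ_1 ^ 2 > b_2 > θ_d ^ 2` for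
`d = ⌊D/2⌋`, so the denominator does not vanish at `z = θ_1` or `z = θ_d`. -/
def tilde {X : Type*} [Fintype X] (G : SimpleGraph X) (z : ℝ) : ℝ :=
  -1 - (b G 2 : ℝ) * (b G 3 : ℝ) / (z ^ 2 - (b G 2 : ℝ))

/-- The subspace `Mv = {B v : B ∈ M}`. -/
def boseMesnerSpan {X : Type*} [Fintype X] [DecidableEq X] (G : SimpleGraph X) (v : X → ℂ) :
    Submodule ℂ (X → ℂ) :=
  (Subalgebra.toSubmodule (boseMesner G)).map ((Matrix.mulVecBilin ℂ ℂ).flip v)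

end

end DRG

/-! Two independent facts give the theorem. First, `eq_boseMesnerSpan`: raising `v` repeatedly
produces one vector in each component of `W`. By thinness, `A` acts on these vectors by a three-term
recurrence, so their span is a `T`-module, hence all of `W`, and each of them lies in `Mv`. Thus `W`
is spanned by the projections of `v` onto the eigenspaces of `A`, and nonzero projections are
independent. It remains to see which ones vanish.

Second, the projection `E` for an eigenvalue `t` has entries `f (G.dist y z)` that depend on
distance only. Vertices at distance 2 from `x` are at mutual distance 0, 2 or 4, and the entries of
`v` sum to zero, so on these vertices `E v` is the scalar `f 0 - f 4 + η (f 2 - f 4)` times `v`,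
where `η` is the local eigenvalue (`eigenprojection_mulVec_apply`). The recurrence for `f`
(`exists_profile_recurrence`) turns this scalar, for `η = tilde G s`, into a nonzero multiple of
`(k² - t²)(s² - t²)`. As `⟨v, E v⟩ = ‖E v‖²`, the scalar decides whether `E v = 0`
(`eigenprojection_mulVec_eq_zero_iff`). The spectrum is symmetric about 0, so the vanishing indices
are `0`, `D`, `n`, `D - n`.

The condition `θ_n² ≠ b_2` comes from the identity `∑ E_i = I`, read off at distances 2 and 4
(`exists_weights_sum_eq_zero`). -/

namespace DRG

/-! ### Distances and intersection numbers in a bipartite distance-regular graph -/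

section Combinatorics

variable {X : Type*} [Fintype X] {G : SimpleGraph X}

theorem IsDistanceRegular.dist_le_diam (hG : IsDistanceRegular G) (y z : X) :
    G.dist y z ≤ G.diam :=
  haveI : Nonempty X := ⟨y⟩
  SimpleGraph.dist_le_diam (SimpleGraph.connected_iff_ediam_ne_top.1 hG.1)

theorem IsDistanceRegular.card_eq (hG : IsDistanceRegular G) {h i j : ℕ} (hi : i ≤ G.diam)
    (hj : j ≤ G.diam) {y z : X} (hyz : G.dist y z = h) :
    (Finset.univ.filter fun w : X => G.dist y w = i ∧ G.dist w z = j).card =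
      intersectionNumber G h i j := by
  obtain ⟨p, hp⟩ := hG.2 h i j (hyz ▸ hG.dist_le_diam y z) hi hj
  refine le_antisymm ?_ ?_
  · exact Finset.le_sup (s := Finset.univ.filter fun q : X × X => G.dist q.1 q.2 = h)
      (f := fun q => (Finset.univ.filter fun w : X => G.dist q.1 w = i ∧ G.dist w q.2 = j).card)
      (b := (y, z)) (by simpa using hyz)
  · refine Finset.sup_le fun q hq => ?_
    rw [hp _ _ (by simpa using hq), hp _ _ hyz]

omit [Fintype X] in
theorem even_dist_iff (hG : G.Connected) (C : G.Coloring Bool) (y z : X) :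
    Even (G.dist y z) ↔ (C y = true ↔ C z = true) := by
  obtain ⟨p, hp⟩ := hG.exists_walk_length_eq_dist y z
  rw [← hp, C.even_length_iff_congr]

omit [Fintype X] in
theorem exists_coloring (hbip : G.IsBipartite) : Nonempty (G.Coloring Bool) :=
  ⟨hbip.toColoring (by simp)⟩

-- The triangle inequality allows a change of at most 1, and the 2-colouring fixes the parity of
-- distances, which excludes a change of 0.
omit [Fintype X] in
theorem dist_eq_pred_or_succ (hG : G.Connected) (hbip : G.IsBipartite) {y w z : X}
    (hyw : G.dist y w = 1) :
    G.dist w z + 1 = G.dist y z ∨ G.dist w z = G.dist y z + 1 := by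
  obtain ⟨C⟩ := exists_coloring hbip
  have h1 : G.dist y z ≤ G.dist y w + G.dist w z := hG.dist_triangle
  have h2 : G.dist w z ≤ G.dist w y + G.dist y z := hG.dist_triangle
  rw [G.dist_comm (u := w) (v := y)] at h2
  have e1 := even_dist_iff hG C y z
  have e2 := even_dist_iff hG C w z
  have e3 := even_dist_iff hG C y w
  rw [hyw] at e3
  have : ¬ (Even 1) := by decide
  by_cases h : G.dist y z = G.dist w z
  · rw [h] at e1; tauto
  · omega

omit [Fintype X] in
theorem even_dist_of_dist_eq (hG : G.Connected) (hbip : G.IsBipartite) {x y z : X}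
    (h : G.dist x y = G.dist x z) : Even (G.dist y z) := by
  obtain ⟨C⟩ := exists_coloring hbip
  have e1 := even_dist_iff hG C y z
  have e2 := even_dist_iff hG C x y
  have e3 := even_dist_iff hG C x z
  rw [h] at e2
  tauto

omit [Fintype X] in
theorem exists_dist_eq_one (hG : G.Connected) {y z : X} {j : ℕ} (h : G.dist y z = j + 1) :
    ∃ w, G.dist y w = 1 ∧ G.dist w z = j := by
  obtain ⟨p, hp⟩ := hG.exists_walk_length_eq_dist y z
  cases p with
  | nil => simp at h
  | @cons _ w _ a q =>
    have h1 : G.dist y w = 1 := SimpleGraph.dist_eq_one_iff_adj.2 a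
    refine ⟨w, h1, ?_⟩
    have h2 : G.dist y z ≤ G.dist y w + G.dist w z := hG.dist_triangle
    have h3 := SimpleGraph.dist_le q
    simp only [SimpleGraph.Walk.length_cons] at hp
    omega

omit [Fintype X] in
theorem exists_dist_eq (hG : G.Connected) {j : ℕ} (hj : j ≤ G.diam) :
    ∃ y z, G.dist y z = j := by
  have := hG.nonempty
  obtain ⟨y, z, h⟩ := G.exists_dist_eq_diam
  induction hj using Nat.decreasingInduction with
  | self => exact ⟨y, z, h⟩
  | of_succ i hi ih =>
    obtain ⟨y, z, h⟩ := ih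
    obtain ⟨w, -, hw⟩ := exists_dist_eq_one hG h
    exact ⟨w, z, hw⟩

/-- The intersection number `c_i = p^i_{1,i-1}`. -/
noncomputable def c (G : SimpleGraph X) (i : ℕ) : ℕ :=
  intersectionNumber G i 1 (i - 1)

theorem IsDistanceRegular.c_pos (hG : IsDistanceRegular G) {j : ℕ} (hj : j + 1 ≤ G.diam) :
    0 < c G (j + 1) := by
  obtain ⟨y, z, h⟩ := exists_dist_eq hG.1 hj
  obtain ⟨w, hw⟩ := exists_dist_eq_one hG.1 h
  rw [c, ← hG.card_eq (by omega) (by omega) h, Finset.card_pos]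
  exact ⟨w, by simpa using hw⟩

theorem IsDistanceRegular.b_pos (hG : IsDistanceRegular G) {j : ℕ} (hj : j + 1 ≤ G.diam) :
    0 < b G j := by
  obtain ⟨y, z, h⟩ := exists_dist_eq hG.1 hj
  obtain ⟨w, hw, hw'⟩ := exists_dist_eq_one hG.1 h
  rw [b, ← hG.card_eq (by omega) (by omega) hw', Finset.card_pos]
  exact ⟨y, by simp [G.dist_comm (u := w), hw, h]⟩

theorem IsDistanceRegular.c_one (hG : IsDistanceRegular G) (hD : 1 ≤ G.diam) : c G 1 = 1 := by
  obtain ⟨y, z, h⟩ := exists_dist_eq hG.1 hD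
  rw [c, ← hG.card_eq (by omega) (by omega) h, Finset.card_eq_one]
  refine ⟨z, ?_⟩
  ext w
  simp only [Finset.mem_filter, Finset.mem_univ, true_and, Finset.mem_singleton, Nat.sub_self,
    hG.1.dist_eq_zero_iff]
  constructor
  · exact fun h => h.2
  · rintro rfl; exact ⟨h, rfl⟩

/-- Source of the three-term recurrences: in a bipartite graph no neighbour of `y` keeps the same
distance to `z`, so only the `c` and `b` terms occur. Constant `f` gives `c_i + b_i = k`. -/
theorem sum_neighbors (hG : IsDistanceRegular G) (hbip : G.IsBipartite) {R : Type*}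
    [CommSemiring R] (f : ℕ → R) {j : ℕ} (hj : j + 2 ≤ G.diam) {y z : X}
    (h : G.dist y z = j + 1) :
    ∑ w with G.dist y w = 1, f (G.dist w z) =
      (c G (j + 1) : R) * f j + (b G (j + 1) : R) * f (j + 2) := by
  rw [c, b, ← hG.card_eq (by omega) (by omega) h, ← hG.card_eq (by omega) (by omega) h,
    ← Finset.sum_filter_add_sum_filter_not _ (fun w => G.dist w z = j), Finset.filter_filter,
    Finset.filter_filter]
  have key : ∀ w, (G.dist y w = 1 ∧ ¬ G.dist w z = j) ↔
      (G.dist y w = 1 ∧ G.dist w z = j + 1 + 1) := by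
    intro w
    refine and_congr_right fun hw => ?_
    have := dist_eq_pred_or_succ hG.1 hbip (z := z) hw
    omega
  simp only [key, Nat.add_sub_cancel]
  congr 1
  · rw [Finset.sum_congr rfl (g := fun _ => f j)
      (fun w hw => by rw [(Finset.mem_filter.1 hw).2.2])]
    simp
  · rw [Finset.sum_congr rfl (g := fun _ => f (j + 2))
      (fun w hw => by rw [(Finset.mem_filter.1 hw).2.2])]
    simp

theorem card_dist_eq_one [DecidableRel G.Adj] {k : ℕ} (hreg : G.IsRegularOfDegree k) (y : X) :
    (Finset.univ.filter fun w : X => G.dist y w = 1).card = k := by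
  rw [← hreg y, ← SimpleGraph.card_neighborFinset_eq_degree]
  congr 1
  ext w
  simp [SimpleGraph.dist_eq_one_iff_adj]

theorem sum_neighbors_self [DecidableRel G.Adj] {k : ℕ} (hreg : G.IsRegularOfDegree k)
    {R : Type*} [CommSemiring R] (f : ℕ → R) (y : X) :
    ∑ w with G.dist y w = 1, f (G.dist w y) = (k : R) * f 1 := by
  rw [← card_dist_eq_one hreg y, Finset.sum_congr rfl (g := fun _ => f 1)
      (fun w hw => by rw [G.dist_comm, (Finset.mem_filter.1 hw).2])]
  simp

theorem IsDistanceRegular.c_add_b [DecidableRel G.Adj] (hG : IsDistanceRegular G)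
    (hbip : G.IsBipartite) {k : ℕ} (hreg : G.IsRegularOfDegree k) {j : ℕ}
    (hj : j + 2 ≤ G.diam) : c G (j + 1) + b G (j + 1) = k := by
  obtain ⟨y, z, h⟩ := exists_dist_eq hG.1 (show j + 1 ≤ G.diam by omega)
  have := sum_neighbors hG hbip (fun _ => (1 : ℕ)) hj h
  simp only [Finset.sum_const, smul_eq_mul, mul_one, Nat.cast_id] at this
  rw [← this, card_dist_eq_one hreg]

end Combinatorics

/-! ### Elements of the Bose-Mesner algebra depend on distance only -/

section Radial

variable {X : Type*} [Fintype X] {G : SimpleGraph X}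

/-- A matrix whose entries depend only on the distance. -/
def IsRadial (G : SimpleGraph X) (B : Matrix X X ℂ) : Prop :=
  ∃ f : ℕ → ℂ, ∀ y z, B y z = f (G.dist y z)

theorem adjacency_mul_apply (B : Matrix X X ℂ) (y z : X) :
    (adjacency G * B) y z = ∑ w with G.dist y w = 1, B w z := by
  simp [Matrix.mul_apply, adjacency, distMatrix, Finset.sum_filter]

theorem adjacency_mulVec_apply (u : X → ℂ) (y : X) :
    (adjacency G *ᵥ u) y = ∑ w with G.dist y w = 1, u w := by
  simp [Matrix.mulVec, dotProduct, adjacency, distMatrix, Finset.sum_filter]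

theorem IsRadial.adjacency_mul (hG : IsDistanceRegular G) (hD : 1 ≤ G.diam)
    {B : Matrix X X ℂ} (hB : IsRadial G B) : IsRadial G (adjacency G * B) := by
  obtain ⟨f, hf⟩ := hB
  refine ⟨fun h => ∑ i ∈ Finset.range (G.diam + 1), (intersectionNumber G h 1 i : ℂ) * f i,
    fun y z => ?_⟩
  rw [adjacency_mul_apply, ← Finset.sum_fiberwise_of_maps_to (t := Finset.range (G.diam + 1))
    (g := fun w => G.dist w z)
    (fun w _ => Finset.mem_range.2 (Nat.lt_succ_of_le (hG.dist_le_diam w z)))]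
  refine Finset.sum_congr rfl fun i hi => ?_
  rw [Finset.filter_filter, ← hG.card_eq hD (Nat.le_of_lt_succ (Finset.mem_range.1 hi)) rfl,
    Finset.sum_congr rfl (g := fun _ => f i)
      (fun w hw => by rw [hf, (Finset.mem_filter.1 hw).2.2])]
  simp

theorem isRadial_of_mem_boseMesner [DecidableEq X] (hG : IsDistanceRegular G)
    (hD : 1 ≤ G.diam) {B : Matrix X X ℂ} (hB : B ∈ boseMesner G) : IsRadial G B := by
  rw [boseMesner, Algebra.adjoin_singleton_eq_range_aeval] at hB
  obtain ⟨p, rfl⟩ := hB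
  induction p using Polynomial.induction_on' with
  | add p q hp hq =>
    obtain ⟨f, hf⟩ := hp
    obtain ⟨g, hg⟩ := hq
    exact ⟨fun i => f i + g i, fun y z => by rw [map_add, Matrix.add_apply, hf, hg]⟩
  | monomial n a =>
    have : IsRadial G (adjacency G ^ n) := by
      induction n with
      | zero =>
        exact ⟨fun i => if i = 0 then 1 else 0, fun y z => by
          simp [Matrix.one_apply, hG.1.dist_eq_zero_iff]⟩
      | succ n ih => rw [pow_succ']; exact ih.adjacency_mul hG hD
    obtain ⟨f, hf⟩ := this
    exact ⟨fun i => a * f i, fun y z => by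
      change (Polynomial.aeval (adjacency G) (Polynomial.monomial n a)) y z = _
      rw [Polynomial.aeval_monomial, ← Algebra.smul_def, Matrix.smul_apply, hf, smul_eq_mul]⟩

end Radial

end DRG

namespace DRG

/-! ### Spectral decomposition of the adjacency matrix -/

section Spectral

variable {X : Type*} [Fintype X] [DecidableEq X] {G : SimpleGraph X}

/-- The matrix of the orthogonal projection onto the eigenspace of `A` for `t`. -/
noncomputable def eigenprojection (G : SimpleGraph X) (t : ℝ) : Matrix X X ℂ :=
  Matrix.toEuclideanLin.symm
    ((Module.End.eigenspace (Matrix.toEuclideanLin (adjacency G))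
      (t : ℂ)).starProjection : EuclideanSpace ℂ X →ₗ[ℂ] EuclideanSpace ℂ X)

theorem eigenprojection_mulVec (t : ℝ) (w : X → ℂ) :
    eigenprojection G t *ᵥ w = WithLp.ofLp ((Module.End.eigenspace
      (Matrix.toEuclideanLin (adjacency G)) (t : ℂ)).starProjection (WithLp.toLp 2 w)) := by
  have := congrArg WithLp.ofLp (Matrix.toLpLin_apply 2 2 (eigenprojection G t) (WithLp.toLp 2 w))
  rw [eigenprojection, LinearEquiv.apply_symm_apply] at this
  exact this.symm

theorem mem_eigenspace_toEuclideanLin {B : Matrix X X ℂ} {t : ℂ} {w : EuclideanSpace ℂ X} :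
    w ∈ Module.End.eigenspace (Matrix.toEuclideanLin B) t ↔
      B *ᵥ (WithLp.ofLp w) = t • (WithLp.ofLp w) := by
  rw [Module.End.mem_eigenspace_iff, Matrix.toLpLin_apply]
  constructor
  · intro h; simpa using congrArg WithLp.ofLp h
  · intro h; rw [h]; rfl

theorem adjacency_mulVec_eigenprojection_mulVec (t : ℝ) (w : X → ℂ) :
    adjacency G *ᵥ (eigenprojection G t *ᵥ w) = (t : ℂ) • (eigenprojection G t *ᵥ w) := by
  rw [eigenprojection_mulVec, ← mem_eigenspace_toEuclideanLin]
  exact Submodule.starProjection_apply_mem _ _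

theorem eigenprojection_mulVec_of_eigenvector {t : ℝ} {w : X → ℂ}
    (h : adjacency G *ᵥ w = (t : ℂ) • w) : eigenprojection G t *ᵥ w = w := by
  rw [eigenprojection_mulVec, Submodule.starProjection_eq_self_iff.2]
  exact mem_eigenspace_toEuclideanLin.2 h

omit [Fintype X] [DecidableEq X] in
theorem adjacency_isHermitian : (adjacency G).IsHermitian := by
  ext y z
  rw [Matrix.conjTranspose_apply, adjacency, distMatrix, Matrix.of_apply, Matrix.of_apply,
    G.dist_comm]
  split_ifs <;> simp

theorem adjacency_isSymmetric : (Matrix.toEuclideanLin (adjacency G)).IsSymmetric :=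
  Matrix.isSymmetric_toEuclideanLin_iff.2 adjacency_isHermitian

theorem eigenprojection_mulVec_of_ne {s t : ℝ} (hst : s ≠ t) {w : X → ℂ}
    (h : adjacency G *ᵥ w = (s : ℂ) • w) : eigenprojection G t *ᵥ w = 0 := by
  rw [eigenprojection_mulVec, (Submodule.starProjection_apply_eq_zero_iff _).2]
  · rfl
  · have := (adjacency_isSymmetric (G := G)).orthogonalFamily_eigenspaces.isOrtho
      (i := (t : ℂ)) (j := (s : ℂ)) (by exact_mod_cast hst.symm)
    exact this.symm (mem_eigenspace_toEuclideanLin.2 h)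

theorem mem_eigenvalueSet {t : ℝ} :
    t ∈ eigenvalueSet G ↔ ∃ w : X → ℂ, w ≠ 0 ∧ adjacency G *ᵥ w = (t : ℂ) • w := by
  rw [eigenvalueSet, Set.Finite.mem_toFinset, Set.mem_ofPred_eq]
  constructor
  · intro h
    obtain ⟨w, hw⟩ := h.exists_hasEigenvector
    exact ⟨w, hw.2, by simpa using hw.apply_eq_smul⟩
  · rintro ⟨w, hw, h⟩
    exact Module.End.hasEigenvalue_of_hasEigenvector (x := w)
      ⟨Module.End.mem_eigenspace_iff.2 (by simpa using h), hw⟩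

theorem iSup_eigenspace_eq_top :
    ⨆ t ∈ eigenvalueSet G,
      Module.End.eigenspace (Matrix.toEuclideanLin (adjacency G)) (t : ℂ) = ⊤ := by
  have h := (adjacency_isSymmetric (G := G)).orthogonalComplement_iSup_eigenspaces_eq_bot
  rw [Submodule.orthogonal_eq_bot_iff] at h
  rw [eq_top_iff, ← h]
  refine iSup_le fun s => ?_
  by_cases hs : Module.End.eigenspace (Matrix.toEuclideanLin (adjacency G)) s = ⊥
  · rw [hs]; exact bot_le
  · have hs' : Module.End.HasEigenvalue (Matrix.toEuclideanLin (adjacency G)) s := hs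
    obtain ⟨r, rfl⟩ : ∃ r : ℝ, (r : ℂ) = s :=
      Complex.conj_eq_iff_real.1 (adjacency_isSymmetric.conj_eigenvalue_eq_self hs') |>.imp
        fun _ h => h.symm
    obtain ⟨w, hw⟩ := hs'.exists_hasEigenvector
    refine le_iSup₂_of_le r (mem_eigenvalueSet.2 ⟨WithLp.ofLp w, ?_, ?_⟩) le_rfl
    · intro h0; exact hw.2 (by ext i; exact congrFun h0 i)
    · exact mem_eigenspace_toEuclideanLin.1 hw.1

/-- Two matrices agreeing on all eigenvectors of `A` are equal. -/
theorem eq_of_eigenvectors {B C : Matrix X X ℂ}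
    (h : ∀ t ∈ eigenvalueSet G, ∀ w : X → ℂ, adjacency G *ᵥ w = (t : ℂ) • w →
      B *ᵥ w = C *ᵥ w) : B = C := by
  apply Matrix.toEuclideanLin.injective
  rw [← LinearMap.eqLocus_eq_top, eq_top_iff, ← iSup_eigenspace_eq_top (G := G)]
  refine iSup₂_le fun t ht w hw => ?_
  rw [LinearMap.mem_eqLocus, Matrix.toLpLin_apply, Matrix.toLpLin_apply,
    h t ht _ (mem_eigenspace_toEuclideanLin.1 hw)]

theorem sum_eigenprojection : ∑ t ∈ eigenvalueSet G, eigenprojection G t = 1 := by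
  refine eq_of_eigenvectors (G := G) fun t ht w hw => ?_
  rw [Matrix.sum_mulVec, Finset.sum_eq_single t, eigenprojection_mulVec_of_eigenvector hw,
    Matrix.one_mulVec]
  · intro s _ hs
    exact eigenprojection_mulVec_of_ne hs.symm hw
  · exact fun h => absurd ht h

theorem aeval_mulVec_of_eigenvector {t : ℂ} {w : X → ℂ}
    (h : adjacency G *ᵥ w = t • w) (p : Polynomial ℂ) :
    (Polynomial.aeval (adjacency G) p) *ᵥ w = p.eval t • w := by
  induction p using Polynomial.induction_on' with
  | add p q hp hq => rw [map_add, Matrix.add_mulVec, hp, hq, Polynomial.eval_add, add_smul]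
  | monomial n a =>
    have : adjacency G ^ n *ᵥ w = t ^ n • w := by
      induction n with
      | zero => simp
      | succ n ih =>
        rw [pow_succ', ← Matrix.mulVec_mulVec, ih, Matrix.mulVec_smul, h, smul_smul, pow_succ]
    rw [Polynomial.aeval_monomial, ← Algebra.smul_def, Matrix.smul_mulVec, this,
      Polynomial.eval_monomial, smul_smul]

/-- The projection is the Lagrange basis polynomial at `t` evaluated at `A`: both act as 1 on the
eigenspace for `t` and as 0 on the others. -/
theorem eigenprojection_mem_boseMesner {t : ℝ} (ht : t ∈ eigenvalueSet G) :
    eigenprojection G t ∈ boseMesner G := by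
  have hinj : Set.InjOn (fun s : ℝ => (s : ℂ)) (eigenvalueSet G : Set ℝ) :=
    Complex.ofReal_injective.injOn
  have : eigenprojection G t = Polynomial.aeval (adjacency G)
      (Lagrange.basis (eigenvalueSet G) (fun s : ℝ => (s : ℂ)) t) := by
    refine eq_of_eigenvectors (G := G) fun s hs w hw => ?_
    rw [aeval_mulVec_of_eigenvector hw]
    by_cases hst : s = t
    · subst hst
      rw [eigenprojection_mulVec_of_eigenvector hw]
      have := Lagrange.eval_basis_self hinj ht
      rw [this, one_smul]
    · rw [eigenprojection_mulVec_of_ne hst hw]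
      have := Lagrange.eval_basis_of_ne (s := eigenvalueSet G) (v := fun s : ℝ => (s : ℂ))
        (Ne.symm hst) hs
      rw [this, zero_smul]
  rw [this, boseMesner]
  exact Polynomial.aeval_mem_adjoin_singleton ℂ _

theorem eigenprojection_isHermitian (t : ℝ) : (eigenprojection G t).IsHermitian := by
  rw [← Matrix.isSymmetric_toEuclideanLin_iff, eigenprojection, LinearEquiv.apply_symm_apply]
  exact Submodule.starProjection_isSymmetric _

theorem star_dotProduct_eigenprojection_mulVec (t : ℝ) (w : X → ℂ) :
    star w ⬝ᵥ (eigenprojection G t *ᵥ w) =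
      star (eigenprojection G t *ᵥ w) ⬝ᵥ (eigenprojection G t *ᵥ w) := by
  conv_lhs => rw [← eigenprojection_mulVec_of_eigenvector
    (adjacency_mulVec_eigenprojection_mulVec (G := G) t w)]
  rw [Matrix.dotProduct_mulVec, Matrix.star_mulVec, (eigenprojection_isHermitian t).eq]

-- Since `E` is a Hermitian idempotent, the inner product of `w` with `E w` is `‖E w‖²`.
open scoped ComplexOrder in
theorem eigenprojection_mulVec_eq_zero_of_orthogonal {t : ℝ} {w : X → ℂ}
    (h : star w ⬝ᵥ (eigenprojection G t *ᵥ w) = 0) : eigenprojection G t *ᵥ w = 0 := by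
  rw [star_dotProduct_eigenprojection_mulVec] at h
  exact dotProduct_star_self_eq_zero.1 h

/-- `M v` is spanned by the projections of `v`. -/
theorem boseMesnerSpan_eq_span (v : X → ℂ) :
    boseMesnerSpan G v =
      Submodule.span ℂ ((fun t => eigenprojection G t *ᵥ v) '' (eigenvalueSet G : Set ℝ)) := by
  apply le_antisymm
  · rintro _ ⟨B, hB, rfl⟩
    replace hB : B ∈ boseMesner G := hB
    rw [boseMesner, Algebra.adjoin_singleton_eq_range_aeval] at hB
    obtain ⟨p, rfl⟩ := hB
    change Polynomial.aeval (adjacency G) p *ᵥ v ∈ _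
    have : v = ∑ t ∈ eigenvalueSet G, eigenprojection G t *ᵥ v := by
      rw [← Matrix.sum_mulVec, sum_eigenprojection, Matrix.one_mulVec]
    rw [this, Matrix.mulVec_sum]
    refine Submodule.sum_mem _ fun t ht => ?_
    rw [aeval_mulVec_of_eigenvector (adjacency_mulVec_eigenprojection_mulVec t v), ← this]
    exact Submodule.smul_mem _ _ (Submodule.subset_span ⟨t, ht, rfl⟩)
  · rw [Submodule.span_le]
    rintro _ ⟨t, ht, rfl⟩
    exact ⟨eigenprojection G t, eigenprojection_mem_boseMesner ht, rfl⟩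

end Spectral

end DRG

namespace DRG

/-! ### Decreasing enumeration of a finite set of reals -/

section SortedList

theorem sort_getD_mem {S : Finset ℝ} {i : ℕ} (hi : i < S.card) :
    (S.sort (· ≥ ·)).getD i 0 ∈ S := by
  have hl : i < (S.sort (· ≥ ·)).length := by rwa [Finset.length_sort]
  rw [List.getD_eq_getElem _ _ hl, ← Finset.mem_sort (· ≥ ·)]
  exact List.getElem_mem hl

theorem sort_getD_lt {S : Finset ℝ} {i j : ℕ} (hij : i < j) (hj : j < S.card) :
    (S.sort (· ≥ ·)).getD j 0 < (S.sort (· ≥ ·)).getD i 0 := by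
  have hl : j < (S.sort (· ≥ ·)).length := by rwa [Finset.length_sort]
  rw [List.getD_eq_getElem _ _ hl, List.getD_eq_getElem _ _ (hij.trans hl)]
  exact List.pairwise_iff_getElem.1 (Finset.sortedGT_sort S).pairwise i j _ _ hij

theorem exists_sort_getD_eq {S : Finset ℝ} {t : ℝ} (ht : t ∈ S) :
    ∃ i < S.card, (S.sort (· ≥ ·)).getD i 0 = t := by
  rw [← Finset.mem_sort (· ≥ ·)] at ht
  obtain ⟨i, hi, h⟩ := List.getElem_of_mem ht
  refine ⟨i, by rwa [Finset.length_sort] at hi, ?_⟩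
  rw [List.getD_eq_getElem _ _ hi, h]

/-- Negating and reversing the sorted list gives another sorted list of the same set, hence the same
list. -/
theorem sort_getD_neg {S : Finset ℝ} (hS : ∀ t ∈ S, -t ∈ S) {N i : ℕ} (hN : S.card = N + 1)
    (hi : i ≤ N) : (S.sort (· ≥ ·)).getD (N - i) 0 = -(S.sort (· ≥ ·)).getD i 0 := by
  have hlen : (S.sort (· ≥ ·)).length = N + 1 := by rw [Finset.length_sort, hN]
  have h : S.sort (· ≥ ·) = ((S.sort (· ≥ ·)).map fun t => -t).reverse := by
    refine List.Perm.eq_of_pairwise' (Finset.pairwise_sort S (· ≥ ·)) (r := (· ≥ ·)) ?_ ?_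
    · rw [List.pairwise_reverse, List.pairwise_map]
      exact (Finset.pairwise_sort S (· ≥ ·)).imp fun h => neg_le_neg h
    · rw [List.perm_ext_iff_of_nodup (Finset.sort_nodup _ _)
        (List.nodup_reverse.2 ((Finset.sort_nodup _ _).map neg_injective))]
      intro t
      simp only [Finset.mem_sort, List.mem_reverse, List.mem_map]
      exact ⟨fun h => ⟨-t, hS t h, neg_neg t⟩, by rintro ⟨s, hs, rfl⟩; exact hS s hs⟩
  have h1 : N - i < (S.sort (· ≥ ·)).length := by omega
  have h2 : i < (S.sort (· ≥ ·)).length := by omega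
  have h3 := List.getElem_of_eq h h1
  rw [List.getD_eq_getElem _ _ h1, List.getD_eq_getElem _ _ h2, h3, List.getElem_reverse,
    List.getElem_map]
  congr 2
  rw [List.length_map]
  omega

end SortedList

/-! ### Profiles of the projections; number, symmetry and bounds of the eigenvalues -/

section Eigenvalues

variable {X : Type*} [Fintype X] [DecidableEq X] {G : SimpleGraph X}

-- Positivity of `f 0`: it is the diagonal entry at every vertex `y`, equal to the squared norm of
-- the column of `y`. If it were 0, every column would vanish.
open scoped ComplexOrder in
theorem exists_profile (hG : IsDistanceRegular G) (hD : 1 ≤ G.diam) {t : ℝ}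
    (ht : t ∈ eigenvalueSet G) :
    ∃ (f : ℕ → ℂ) (r : ℝ), 0 < r ∧ f 0 = r ∧
      ∀ y z, eigenprojection G t y z = f (G.dist y z) := by
  obtain ⟨f, hf⟩ := isRadial_of_mem_boseMesner hG hD (eigenprojection_mem_boseMesner ht)
  have key : ∀ y, f 0 = star (Pi.single y (1 : ℂ)) ⬝ᵥ
      (eigenprojection G t *ᵥ Pi.single y (1 : ℂ)) := fun y => by
    rw [Matrix.mulVec_single_one, ← Pi.single_star, star_one, single_one_dotProduct,
      Matrix.col_apply, hf, SimpleGraph.dist_self]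
  obtain ⟨x⟩ := hG.1.nonempty
  have h0 : 0 ≤ f 0 := by
    rw [key x, star_dotProduct_eigenprojection_mulVec]
    exact dotProduct_star_self_nonneg _
  have h1 : f 0 ≠ 0 := by
    intro h
    obtain ⟨w, hw, hAw⟩ := mem_eigenvalueSet.1 ht
    apply hw
    rw [← eigenprojection_mulVec_of_eigenvector hAw]
    have : eigenprojection G t = 0 := by
      ext y z
      have := eigenprojection_mulVec_eq_zero_of_orthogonal ((key z).symm.trans h)
      rw [Matrix.mulVec_single_one] at this
      exact congrFun this y
    rw [this, Matrix.zero_mulVec]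
  obtain ⟨h2, h3⟩ := Complex.le_def.1 h0
  have h4 : ((f 0).re : ℂ) = f 0 := Complex.ext rfl (by simpa using h3)
  refine ⟨f, (f 0).re, lt_of_le_of_ne h2 fun h => h1 ?_, h4.symm, hf⟩
  rw [← h4, ← h]; simp

theorem exists_profile_recurrence [DecidableRel G.Adj] (hG : IsDistanceRegular G)
    (hbip : G.IsBipartite) (hD : 4 ≤ G.diam) {k : ℕ} (hreg : G.IsRegularOfDegree k) {t : ℝ}
    (ht : t ∈ eigenvalueSet G) :
    ∃ (f : ℕ → ℂ) (r : ℝ), 0 < r ∧ f 0 = r ∧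
      (∀ y z, eigenprojection G t y z = f (G.dist y z)) ∧
      (k : ℂ) * (k - 1) * (f 0 - f 2) = ((k : ℂ) ^ 2 - (t : ℂ) ^ 2) * r ∧
      (b G 2 : ℂ) * b G 3 * (k * (k - 1)) * (f 2 - f 4) =
        ((k : ℂ) ^ 2 - (t : ℂ) ^ 2) * ((t : ℂ) ^ 2 - b G 2) * r := by
  obtain ⟨f, r, hr, hf0, hf⟩ := exists_profile hG (by omega) ht
  have hA : adjacency G * eigenprojection G t = (t : ℂ) • eigenprojection G t :=
    Matrix.ext_of_mulVec_single fun y => by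
      rw [← Matrix.mulVec_mulVec, adjacency_mulVec_eigenprojection_mulVec, Matrix.smul_mulVec]
  have hrec : ∀ y z, ∑ w with G.dist y w = 1, f (G.dist w z) = t * f (G.dist y z) := by
    intro y z
    have := congrFun (congrFun hA y) z
    rw [adjacency_mul_apply, Matrix.smul_apply, hf, smul_eq_mul] at this
    simpa only [hf] using this
  obtain ⟨x⟩ := hG.1.nonempty
  have e0 := hrec x x
  rw [sum_neighbors_self hreg, SimpleGraph.dist_self] at e0
  have hstep : ∀ j, j + 2 ≤ 4 →
      (c G (j + 1) : ℂ) * f j + (b G (j + 1) : ℂ) * f (j + 2) = t * f (j + 1) := by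
    intro j hj
    obtain ⟨y, z, h⟩ := exists_dist_eq hG.1 (show j + 1 ≤ G.diam by omega)
    rw [← sum_neighbors hG hbip f (by omega) h, hrec, h]
  have hcb : ∀ j, j + 2 ≤ 4 → (c G (j + 1) : ℂ) = k - b G (j + 1) := by
    intro j hj
    rw [← hG.c_add_b hbip hreg (j := j) (by omega)]
    push_cast; ring
  have hc1 : (c G 1 : ℂ) = 1 := by exact_mod_cast hG.c_one (by omega)
  have hb1 : (b G 1 : ℂ) = k - 1 := by
    have := hcb 0 (by omega)
    rw [zero_add, hc1] at this
    rw [this]; ring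
  have e1 := hstep 0 (by omega)
  have e2 := hstep 1 (by omega)
  have e3 := hstep 2 (by omega)
  rw [hcb _ (by omega)] at e2 e3
  simp only [zero_add, Nat.reduceAdd, hc1, hb1] at e0 e1 e2 e3
  refine ⟨f, r, hr, hf0, hf, ?_, ?_⟩
  -- The relations `e0` to `e3` express `f 1` to `f 4` successively through `f 0`; these
  -- combinations eliminate `f 1` and `f 3`, with denominators cleared.
  · rw [← hf0]
    linear_combination -(k : ℂ) * e1 - (t : ℂ) * e0
  · rw [← hf0]
    linear_combination -((b G 2 : ℂ) * k * (k - 1)) * e3 - (k : ℂ) * (k - 1) * t * e2 +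
      (k : ℂ) * (b G 2 * k - (t : ℂ) ^ 2) * e1 +
      ((t : ℂ) * (b G 2 * k - (t : ℂ) ^ 2) + (k - 1) * t * (k - b G 2)) * e0

theorem adjacency_pow_apply (j : ℕ) (y z : X) :
    (adjacency G ^ j) y z = Nat.card {p : G.Walk y z | p.length = j} := by
  classical
  have : adjacency G = G.adjMatrix ℂ := by
    ext y z
    simp [adjacency, distMatrix, SimpleGraph.adjMatrix_apply]
  rw [this, SimpleGraph.adjMatrix_pow_apply_eq_card_walk, Nat.card_eq_fintype_card]

theorem adjacency_pow_apply_of_lt {j : ℕ} {y z : X} (h : j < G.dist y z) :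
    (adjacency G ^ j) y z = 0 := by
  have : IsEmpty {p : G.Walk y z | p.length = j} :=
    ⟨fun p => absurd (SimpleGraph.dist_le p.1) (by have := p.2.out; omega)⟩
  rw [adjacency_pow_apply, Nat.card_of_isEmpty, Nat.cast_zero]

theorem adjacency_pow_dist_apply_ne_zero (hG : G.Connected) (y z : X) :
    (adjacency G ^ (G.dist y z)) y z ≠ 0 := by
  classical
  obtain ⟨p, hp⟩ := hG.exists_walk_length_eq_dist y z
  have : Nonempty {p : G.Walk y z | p.length = G.dist y z} := ⟨⟨p, hp⟩⟩
  rw [adjacency_pow_apply, Nat.cast_ne_zero]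
  exact Nat.card_pos.ne'

/-- The product of the factors `X - t` annihilates `A`. If its degree were at most the diameter,
then at a pair of vertices at distance equal to that degree only the leading power of `A` would
contribute, and its entry is nonzero. -/
theorem diam_lt_card_eigenvalueSet (hG : G.Connected) : G.diam < (eigenvalueSet G).card := by
  by_contra! hle
  obtain ⟨y, z, h⟩ := exists_dist_eq hG hle
  set P : Polynomial ℂ := ∏ t ∈ eigenvalueSet G, (Polynomial.X - Polynomial.C (t : ℂ)) with hP
  have hmonic : P.Monic := Polynomial.monic_prod_of_monic _ _ fun t _ => Polynomial.monic_X_sub_C _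
  have hdeg : P.natDegree = (eigenvalueSet G).card := by
    rw [hP, Polynomial.natDegree_prod_of_monic _ _ fun t _ => Polynomial.monic_X_sub_C _]
    simp
  have h0 : Polynomial.aeval (adjacency G) P = 0 := by
    refine eq_of_eigenvectors (G := G) fun t ht w hw => ?_
    have : P.eval (t : ℂ) = 0 := by
      rw [hP, Polynomial.eval_prod]
      exact Finset.prod_eq_zero ht (by simp)
    rw [aeval_mulVec_of_eigenvector hw, this, zero_smul, Matrix.zero_mulVec]
  have h1 := congrFun (congrFun h0 y) z
  rw [Polynomial.aeval_eq_sum_range, Matrix.sum_apply, Finset.sum_range_succ,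
    Finset.sum_eq_zero, hmonic.coeff_natDegree, one_smul, zero_add, hdeg, ← h] at h1
  · exact adjacency_pow_dist_apply_ne_zero hG y z h1
  · intro j hj
    rw [Matrix.smul_apply, adjacency_pow_apply_of_lt, smul_zero]
    rw [h, ← hdeg]
    exact Finset.mem_range.1 hj

/-- The column of `x` in each projection is a nonzero eigenvector and a function of the distance to
`x`; such functions form a space of dimension at most `D + 1`. -/
theorem card_eigenvalueSet_le (hG : IsDistanceRegular G) (hD : 1 ≤ G.diam) :
    (eigenvalueSet G).card ≤ G.diam + 1 := by
  obtain ⟨x⟩ := hG.1.nonempty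
  let Φ : (Fin (G.diam + 1) → ℂ) →ₗ[ℂ] (X → ℂ) :=
    LinearMap.funLeft ℂ ℂ fun y => ⟨G.dist y x, Nat.lt_succ_of_le (hG.dist_le_diam y x)⟩
  let u : eigenvalueSet G → X → ℂ := fun t => eigenprojection G t *ᵥ Pi.single x (1 : ℂ)
  have hu : LinearIndependent ℂ u := by
    refine Module.End.eigenvectors_linearIndependent' (Matrix.toLin' (adjacency G))
      (fun t : eigenvalueSet G => ((t : ℝ) : ℂ))
      (Complex.ofReal_injective.comp Subtype.coe_injective) u fun t => ⟨?_, ?_⟩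
    · rw [Module.End.mem_eigenspace_iff, Matrix.toLin'_apply]
      exact adjacency_mulVec_eigenprojection_mulVec _ _
    · obtain ⟨f, r, hr, hf0, hf⟩ := exists_profile hG hD t.2
      intro h
      have := congrFun h x
      simp only [u, Matrix.mulVec_single_one, Matrix.col_apply, hf, SimpleGraph.dist_self, hf0,
        Pi.zero_apply, Complex.ofReal_eq_zero] at this
      exact hr.ne' this
  have hrange : Submodule.span ℂ (Set.range u) ≤ LinearMap.range Φ := by
    rw [Submodule.span_le]
    rintro _ ⟨t, rfl⟩
    obtain ⟨f, r, hr, hf0, hf⟩ := exists_profile hG hD t.2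
    refine ⟨fun i => f i, ?_⟩
    ext y
    simp [Φ, u, LinearMap.funLeft_apply, hf]
  have h1 := finrank_span_eq_card hu
  have h2 := Submodule.finrank_mono hrange
  have h3 := LinearMap.finrank_range_le Φ
  rw [Module.finrank_fin_fun] at h3
  rw [Fintype.card_coe] at h1
  omega

theorem card_eigenvalueSet (hG : IsDistanceRegular G) (hD : 1 ≤ G.diam) :
    (eigenvalueSet G).card = G.diam + 1 :=
  le_antisymm (card_eigenvalueSet_le hG hD) (diam_lt_card_eigenvalueSet hG.1)

/-- Changing the sign of an eigenvector on one colour class negates its eigenvalue. -/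
theorem neg_mem_eigenvalueSet (hbip : G.IsBipartite) {t : ℝ} (ht : t ∈ eigenvalueSet G) :
    -t ∈ eigenvalueSet G := by
  obtain ⟨C⟩ := exists_coloring hbip
  obtain ⟨w, hw, hA⟩ := mem_eigenvalueSet.1 ht
  refine mem_eigenvalueSet.2 ⟨fun y => if C y = true then w y else -w y, ?_, ?_⟩
  · contrapose! hw
    ext y
    have := congrFun hw y
    by_cases h : C y = true <;> simpa [h] using this
  · ext y
    have h1 := congrFun hA y
    rw [adjacency_mulVec_apply, Pi.smul_apply, smul_eq_mul] at h1 ⊢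
    have h2 : ∀ z ∈ Finset.univ.filter (fun z => G.dist y z = 1),
        (if C z = true then w z else -w z) = (if C y = true then -1 else 1) * w z := by
      intro z hz
      have := C.valid (SimpleGraph.dist_eq_one_iff_adj.1 (Finset.mem_filter.1 hz).2)
      cases hy : C y <;> cases hz : C z <;> simp_all
    rw [Finset.sum_congr rfl h2, ← Finset.mul_sum, h1]
    split_ifs <;> push_cast <;> ring

theorem degree_mem_eigenvalueSet [DecidableRel G.Adj] [Nonempty X] {k : ℕ}
    (hreg : G.IsRegularOfDegree k) : (k : ℝ) ∈ eigenvalueSet G := by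
  refine mem_eigenvalueSet.2 ⟨1, one_ne_zero, ?_⟩
  ext y
  rw [adjacency_mulVec_apply]
  simp only [Pi.one_apply, Finset.sum_const, card_dist_eq_one hreg]
  simp

/-- Compare both sides of the eigenvalue equation at an entry of largest modulus. -/
theorem le_degree_of_mem_eigenvalueSet [DecidableRel G.Adj] {k : ℕ}
    (hreg : G.IsRegularOfDegree k) {t : ℝ} (ht : t ∈ eigenvalueSet G) : t ≤ k := by
  obtain ⟨w, hw, hA⟩ := mem_eigenvalueSet.1 ht
  obtain ⟨y₀, hy₀⟩ := Function.ne_iff.1 hw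
  have : Nonempty X := ⟨y₀⟩
  obtain ⟨y, hy⟩ := Finite.exists_max fun y => ‖w y‖
  have hpos : 0 < ‖w y‖ := (norm_pos_iff.2 hy₀).trans_le (hy y₀)
  have h1 := congrFun hA y
  rw [adjacency_mulVec_apply, Pi.smul_apply, smul_eq_mul] at h1
  have h2 : |t| * ‖w y‖ ≤ k * ‖w y‖ := by
    rw [← Real.norm_eq_abs, ← Complex.norm_real, ← norm_mul, ← h1]
    exact (norm_sum_le_of_le _ fun z _ => hy z).trans_eq 
      (by rw [Finset.sum_const, card_dist_eq_one hreg, nsmul_eq_mul])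
  exact (le_abs_self t).trans (le_of_mul_le_mul_right h2 hpos)

variable (hG : IsDistanceRegular G) (hD : 1 ≤ G.diam)
include hG hD

theorem eigenvalue_mem {i : ℕ} (hi : i ≤ G.diam) : eigenvalue G i ∈ eigenvalueSet G :=
  sort_getD_mem (by rw [card_eigenvalueSet hG hD]; omega)

theorem eigenvalue_lt {i j : ℕ} (hij : i < j) (hj : j ≤ G.diam) :
    eigenvalue G j < eigenvalue G i :=
  sort_getD_lt hij (by rw [card_eigenvalueSet hG hD]; omega)

theorem eigenvalue_le {i j : ℕ} (hij : i ≤ j) (hj : j ≤ G.diam) :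
    eigenvalue G j ≤ eigenvalue G i :=
  hij.eq_or_lt.elim (fun h => h ▸ le_rfl) fun h => (eigenvalue_lt hG hD h hj).le

theorem eigenvalue_inj {i j : ℕ} (hi : i ≤ G.diam) (hj : j ≤ G.diam) :
    eigenvalue G i = eigenvalue G j ↔ i = j := by
  refine ⟨fun h => ?_, fun h => h ▸ rfl⟩
  by_contra hne
  rcases Nat.lt_or_gt_of_ne hne with h' | h'
  · exact (eigenvalue_lt hG hD h' hj).ne' h
  · exact (eigenvalue_lt hG hD h' hi).ne h

theorem exists_eigenvalue_eq {t : ℝ} (ht : t ∈ eigenvalueSet G) :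
    ∃ i ≤ G.diam, eigenvalue G i = t := by
  obtain ⟨i, hi, h⟩ := exists_sort_getD_eq ht
  exact ⟨i, by rw [card_eigenvalueSet hG hD] at hi; omega, h⟩

theorem eigenvalue_diam_sub (hbip : G.IsBipartite) {i : ℕ} (hi : i ≤ G.diam) :
    eigenvalue G (G.diam - i) = -eigenvalue G i :=
  sort_getD_neg (fun _ ht => neg_mem_eigenvalueSet hbip ht) (card_eigenvalueSet hG hD) hi

theorem eigenvalue_zero [DecidableRel G.Adj] {k : ℕ} (hreg : G.IsRegularOfDegree k) :
    eigenvalue G 0 = k := by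
  have := hG.1.nonempty
  refine le_antisymm (le_degree_of_mem_eigenvalueSet hreg (eigenvalue_mem hG hD (Nat.zero_le _))) ?_
  obtain ⟨i, hi, h⟩ := exists_eigenvalue_eq hG hD (degree_mem_eigenvalueSet hreg)
  rw [← h]
  exact eigenvalue_le hG hD (Nat.zero_le i) hi

theorem eigenvalue_sq_eq_iff (hbip : G.IsBipartite) {i j : ℕ} (hi : i ≤ G.diam)
    (hj : j ≤ G.diam) :
    eigenvalue G i ^ 2 = eigenvalue G j ^ 2 ↔ i = j ∨ i = G.diam - j := by
  rw [sq_eq_sq_iff_eq_or_eq_neg, ← eigenvalue_diam_sub hG hD hbip hj,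
    eigenvalue_inj hG hD hi hj, eigenvalue_inj hG hD hi (Nat.sub_le _ _)]

end Eigenvalues

end DRG

namespace DRG

/-! ### The inequalities separating `b_2` from the squared eigenvalues -/

section SecondEigenvalue

variable {X : Type*} [Fintype X] [DecidableEq X] {G : SimpleGraph X} [DecidableRel G.Adj]
  (hG : IsDistanceRegular G) (hbip : G.IsBipartite) (hD : 4 ≤ G.diam) {k : ℕ}
  (hreg : G.IsRegularOfDegree k)
include hG hbip hD hreg

/-- The weights are the diagonal entries of the projections. Since the projections sum to `I`, their
entries at distance 2, and likewise at distance 4, sum to 0; the formula for `f 2 - f 4` then yields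
the relation. -/
theorem exists_weights_sum_eq_zero :
    ∃ r : ℝ → ℝ, (∀ t ∈ eigenvalueSet G, 0 < r t) ∧
      ∑ t ∈ eigenvalueSet G, ((k : ℝ) ^ 2 - t ^ 2) * (t ^ 2 - b G 2) * r t = 0 := by
  choose! f r hr h0 hf h1 h2 using
    fun t (ht : t ∈ eigenvalueSet G) => exists_profile_recurrence hG hbip hD hreg ht
  refine ⟨r, hr, ?_⟩
  have hsum : ∀ j, j + 1 ≤ G.diam → ∑ t ∈ eigenvalueSet G, f t (j + 1) = 0 := by
    intro j hj
    obtain ⟨y, z, h⟩ := exists_dist_eq hG.1 hj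
    have := congrFun (congrFun (sum_eigenprojection (G := G)) y) z
    have hyz : y ≠ z := by rintro rfl; simp at h
    rw [Matrix.sum_apply, Matrix.one_apply_ne hyz] at this
    rw [← this]
    exact Finset.sum_congr rfl fun t ht => by rw [hf t ht, h]
  have : (∑ t ∈ eigenvalueSet G,
      (((k : ℝ) ^ 2 - t ^ 2) * (t ^ 2 - b G 2) * r t : ℝ) : ℂ) = 0 := by
    -- The right side becomes a constant times `0 - 0`, so that the two zeros can be replaced by the
    -- sums at distances 2 and 4.
    rw [← mul_zero ((b G 2 : ℂ) * b G 3 * (k * (k - 1))), ← sub_self (0 : ℂ)]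
    conv_rhs => rw [← hsum 1 (by omega)]
    nth_rw 2 [hsum 1 (by omega)]
    rw [← hsum 3 (by omega), ← Finset.sum_sub_distrib, Finset.mul_sum]
    refine Finset.sum_congr rfl fun t ht => ?_
    rw [h2 t ht]
    push_cast
    ring
  exact_mod_cast this

/-- Otherwise `θ_1² = θ_2² = b_2`, which forces `1 = D - 2`, against `D ≥ 4`. This makes one term of
the weighted sum nonzero. -/
theorem exists_not_sq_eq :
    ∃ t ∈ eigenvalueSet G, t ^ 2 ≠ (k : ℝ) ^ 2 ∧ t ^ 2 ≠ b G 2 := by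
  by_contra! h
  have h0 := eigenvalue_zero hG (by omega) hreg
  have key : ∀ i, 0 < i → i < G.diam → eigenvalue G i ^ 2 = b G 2 := fun i hi hi' => by
    refine h _ (eigenvalue_mem hG (by omega) hi'.le) fun hik => ?_
    rw [← h0, eigenvalue_sq_eq_iff hG (by omega) hbip hi'.le (Nat.zero_le _)] at hik
    omega
  have h12 := (key 1 (by omega) (by omega)).trans (key 2 (by omega) (by omega)).symm
  rw [eigenvalue_sq_eq_iff hG (by omega) hbip (by omega) (by omega)] at h12
  omega

omit hG hD in
theorem sq_le_degree_sq {t : ℝ} (ht : t ∈ eigenvalueSet G) : t ^ 2 ≤ (k : ℝ) ^ 2 :=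
  sq_le_sq' (neg_le.1 (le_degree_of_mem_eigenvalueSet hreg (neg_mem_eigenvalueSet hbip ht)))
    (le_degree_of_mem_eigenvalueSet hreg ht)

/-- Otherwise no term of the weighted sum is positive and one is negative, so the sum is not 0. -/
theorem exists_b_lt_sq :
    ∃ t ∈ eigenvalueSet G, t ^ 2 ≠ (k : ℝ) ^ 2 ∧ (b G 2 : ℝ) < t ^ 2 := by
  by_contra! h
  obtain ⟨r, hr, hsum⟩ := exists_weights_sum_eq_zero hG hbip hD hreg
  obtain ⟨s, hs, hsk, hsb⟩ := exists_not_sq_eq hG hbip hD hreg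
  refine (Finset.sum_neg' (fun t ht => ?_) ⟨s, hs, ?_⟩).ne hsum
  · by_cases htk : t ^ 2 = (k : ℝ) ^ 2
    · rw [htk]; simp
    · exact mul_nonpos_of_nonpos_of_nonneg (mul_nonpos_of_nonneg_of_nonpos
        (sub_nonneg.2 (sq_le_degree_sq hbip hreg ht)) (sub_nonpos.2 (h t ht htk)))
        (hr t ht).le
  · exact mul_neg_of_neg_of_pos (mul_neg_of_pos_of_neg
      (sub_pos.2 (lt_of_le_of_ne (sq_le_degree_sq hbip hreg hs) hsk))
      (sub_neg.2 (lt_of_le_of_ne (h s hs hsk) hsb))) (hr s hs)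

theorem exists_sq_lt_b :
    ∃ t ∈ eigenvalueSet G, t ^ 2 ≠ (k : ℝ) ^ 2 ∧ t ^ 2 < (b G 2 : ℝ) := by
  by_contra! h
  obtain ⟨r, hr, hsum⟩ := exists_weights_sum_eq_zero hG hbip hD hreg
  obtain ⟨s, hs, hsk, hsb⟩ := exists_not_sq_eq hG hbip hD hreg
  refine (Finset.sum_pos' (fun t ht => ?_) ⟨s, hs, ?_⟩).ne' hsum
  · by_cases htk : t ^ 2 = (k : ℝ) ^ 2
    · rw [htk]; simp
    · exact mul_nonneg (mul_nonneg (sub_nonneg.2 (sq_le_degree_sq hbip hreg ht))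
        (sub_nonneg.2 (h t ht htk))) (hr t ht).le
  · exact mul_pos (mul_pos
      (sub_pos.2 (lt_of_le_of_ne (sq_le_degree_sq hbip hreg hs) hsk))
      (sub_pos.2 (lt_of_le_of_ne (h s hs hsk) (Ne.symm hsb)))) (hr s hs)

theorem b_two_lt_eigenvalue_one_sq : (b G 2 : ℝ) < eigenvalue G 1 ^ 2 := by
  obtain ⟨t, ht, htk, hlt⟩ := exists_b_lt_sq hG hbip hD hreg
  obtain ⟨i, hi, rfl⟩ := exists_eigenvalue_eq hG (by omega) ht
  rw [← eigenvalue_zero hG (by omega) hreg, Ne,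
    eigenvalue_sq_eq_iff hG (by omega) hbip hi (Nat.zero_le _)] at htk
  -- With `±k` excluded, `i` lies strictly between 0 and `D`, so `θ_i` lies between `-θ_1 = θ_{D-1}`
  -- and `θ_1`.
  refine hlt.trans_le (sq_le_sq' ?_ (eigenvalue_le hG (by omega) (by omega) hi))
  rw [← eigenvalue_diam_sub hG (by omega) hbip (by omega)]
  exact eigenvalue_le hG (by omega) (by omega) (by omega)

/-- For `D = 2d + 1` the middle eigenvalues are `θ_d > 0` and `θ_{d+1} = -θ_d`, so `θ_d²` is the
smallest squared eigenvalue. -/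
theorem eigenvalue_half_sq_lt_b_two (hodd : Odd G.diam) :
    eigenvalue G (G.diam / 2) ^ 2 < (b G 2 : ℝ) := by
  obtain ⟨t, ht, htk, hlt⟩ := exists_sq_lt_b hG hbip hD hreg
  obtain ⟨i, hi, rfl⟩ := exists_eigenvalue_eq hG (by omega) ht
  refine lt_of_le_of_lt ?_ hlt
  obtain ⟨d, hd⟩ := hodd
  have hd2 : G.diam / 2 = d := by omega
  have h1 := eigenvalue_diam_sub hG (by omega) hbip (show d ≤ G.diam by omega)
  have h2 := eigenvalue_lt hG (by omega) (show d < G.diam - d by omega) (by omega)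
  rw [hd2, sq_le_sq, abs_of_pos (by linarith : 0 < eigenvalue G d)]
  rcases le_or_gt i d with h | h
  · exact (eigenvalue_le hG (by omega) h (by omega)).trans (le_abs_self _)
  · have := eigenvalue_le hG (by omega) (show G.diam - d ≤ i by omega) hi
    exact le_trans (by linarith) (neg_le_abs _)

end SecondEigenvalue

/-! ### Thin irreducible modules are generated over `M` by their first component -/

section Modules

variable {X : Type*} [Fintype X] [DecidableEq X] {G : SimpleGraph X} {x : X}
  {W : Submodule ℂ (X → ℂ)}

theorem dualIdempotent_mulVec_apply (j : ℕ) (w : X → ℂ) (y : X) :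
    (dualIdempotent G x j *ᵥ w) y = if G.dist x y = j then w y else 0 := by
  rw [dualIdempotent, Matrix.mulVec_diagonal]
  split_ifs <;> simp

theorem dualIdempotent_mulVec_dualIdempotent_mulVec (i j : ℕ) (w : X → ℂ) :
    dualIdempotent G x i *ᵥ (dualIdempotent G x j *ᵥ w) =
      if i = j then dualIdempotent G x j *ᵥ w else 0 := by
  ext y
  rw [dualIdempotent_mulVec_apply, dualIdempotent_mulVec_apply]
  by_cases hij : i = j
  · subst hij
    rw [if_pos rfl, dualIdempotent_mulVec_apply]
    split_ifs <;> rfl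
  · rw [if_neg hij, Pi.zero_apply]
    split_ifs
    · omega
    · rfl
    · rfl

theorem IsTModule.adjacency_mulVec_mem (hW : IsTModule G x W) {w : X → ℂ} (hw : w ∈ W) :
    adjacency G *ᵥ w ∈ W :=
  hW _ (le_sup_left (a := boseMesner G) (Algebra.self_mem_adjoin_singleton ℂ _)) w hw

theorem IsTModule.dualIdempotent_mulVec_mem (hW : IsTModule G x W) (j : ℕ) {w : X → ℂ}
    (hw : w ∈ W) : dualIdempotent G x j *ᵥ w ∈ W :=
  hW _ (le_sup_right (a := boseMesner G) (Algebra.subset_adjoin ⟨j, rfl⟩)) w hw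

theorem isTModule_of_generators (hA : ∀ w ∈ W, adjacency G *ᵥ w ∈ W)
    (hE : ∀ j, ∀ w ∈ W, dualIdempotent G x j *ᵥ w ∈ W) : IsTModule G x W := by
  let S : Subalgebra ℂ (Matrix X X ℂ) :=
    { carrier := {B | ∀ w ∈ W, B *ᵥ w ∈ W}
      mul_mem' := fun {B C} hB hC w hw => by
        rw [← Matrix.mulVec_mulVec]; exact hB _ (hC w hw)
      add_mem' := fun {B C} hB hC w hw => by
        rw [Matrix.add_mulVec]; exact W.add_mem (hB w hw) (hC w hw)
      algebraMap_mem' := fun a w hw => by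
        rw [Algebra.algebraMap_eq_smul_one, Matrix.smul_mulVec, Matrix.one_mulVec]
        exact W.smul_mem a hw }
  have : subconstituentAlgebra G x ≤ S := by
    refine sup_le (Algebra.adjoin_le ?_) (Algebra.adjoin_le ?_)
    · rintro _ rfl; exact hA
    · rintro _ ⟨j, rfl⟩; exact hE j
  exact fun B hB => this hB

theorem IsTModule.mem_dualComponent (hW : IsTModule G x W) {j : ℕ} {w : X → ℂ} :
    w ∈ dualComponent G x j W ↔ w ∈ W ∧ dualIdempotent G x j *ᵥ w = w := by
  constructor
  · rintro ⟨u, hu, rfl⟩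
    refine ⟨hW.dualIdempotent_mulVec_mem j hu, ?_⟩
    simp only [Matrix.mulVecLin_apply]
    rw [dualIdempotent_mulVec_dualIdempotent_mulVec, if_pos rfl]
  · rintro ⟨hw, h⟩
    exact ⟨w, hw, h⟩

theorem dualComponent_eq_bot_of_lt_endpoint {j : ℕ} (hj : j ≤ G.diam)
    (h : j < endpoint G x W) : dualComponent G x j W = ⊥ := by
  by_contra hne
  exact Nat.notMem_of_lt_sInf h ⟨hj, hne⟩

theorem IsThin.exists_smul_eq (hthin : IsThin G x W) {j : ℕ} (hj : j ≤ G.diam) {u w : X → ℂ}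
    (hu : u ∈ dualComponent G x j W) (hu0 : u ≠ 0) (hw : w ∈ dualComponent G x j W) :
    ∃ a : ℂ, w = a • u := by
  obtain ⟨e, he⟩ := finrank_le_one_iff.1 (hthin j hj)
  obtain ⟨a, ha⟩ := he ⟨u, hu⟩
  obtain ⟨a', ha'⟩ := he ⟨w, hw⟩
  have ha0 : a ≠ 0 := by
    rintro rfl
    exact hu0 (by simpa using (congrArg Subtype.val ha).symm)
  refine ⟨a' / a, ?_⟩
  have h1 : a • (e : X → ℂ) = u := congrArg Subtype.val ha
  have h2 : a' • (e : X → ℂ) = w := congrArg Subtype.val ha'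
  rw [← h1, ← h2, smul_smul, div_mul_cancel₀ _ ha0]

theorem adjacency_mulVec_eq_add (hG : G.Connected) (hbip : G.IsBipartite) {j : ℕ} {w : X → ℂ}
    (hw : dualIdempotent G x (j + 1) *ᵥ w = w) :
    adjacency G *ᵥ w = dualIdempotent G x (j + 2) *ᵥ (adjacency G *ᵥ w) +
      dualIdempotent G x j *ᵥ (adjacency G *ᵥ w) := by
  ext y
  rw [Pi.add_apply, dualIdempotent_mulVec_apply, dualIdempotent_mulVec_apply]
  by_cases h1 : G.dist x y = j + 2
  · rw [if_pos h1, if_neg (by omega), add_zero]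
  by_cases h2 : G.dist x y = j
  · rw [if_neg h1, if_pos h2, zero_add]
  rw [if_neg h1, if_neg h2, add_zero, adjacency_mulVec_apply]
  refine Finset.sum_eq_zero fun z hz => ?_
  have hyz := (Finset.mem_filter.1 hz).2
  have := dist_eq_pred_or_succ hG hbip (z := x) hyz
  rw [G.dist_comm (u := z), G.dist_comm (u := y)] at this
  rw [← hw, dualIdempotent_mulVec_apply, if_neg (by omega)]

theorem self_mem_boseMesnerSpan (v : X → ℂ) : v ∈ boseMesnerSpan G v :=
  ⟨1, (boseMesner G).one_mem, by simp⟩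

theorem adjacency_mulVec_mem_boseMesnerSpan {v w : X → ℂ} (hw : w ∈ boseMesnerSpan G v) :
    adjacency G *ᵥ w ∈ boseMesnerSpan G v := by
  obtain ⟨B, hB, rfl⟩ := hw
  exact ⟨adjacency G * B, (boseMesner G).mul_mem (Algebra.self_mem_adjoin_singleton ℂ _) hB,
    by simp [Matrix.mulVec_mulVec]⟩

theorem IsTModule.boseMesnerSpan_le (hW : IsTModule G x W) {v : X → ℂ} (hv : v ∈ W) :
    boseMesnerSpan G v ≤ W := by
  rintro _ ⟨B, hB, rfl⟩
  exact hW B (le_sup_left (a := boseMesner G) hB) v hv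

/-- The successive components `E*_{r+i} A E*_{r+i-1} A ⋯ E*_r v`. -/
noncomputable def raise (G : SimpleGraph X) (x : X) (r : ℕ) (v : X → ℂ) : ℕ → X → ℂ
  | 0 => v
  | i + 1 => dualIdempotent G x (r + i + 1) *ᵥ (adjacency G *ᵥ raise G x r v i)

/-- A thin irreducible module with endpoint `r ≥ 1` is generated over the Bose-Mesner algebra by
any nonzero vector of its first component. -/
theorem eq_boseMesnerSpan (hG : IsDistanceRegular G) (hbip : G.IsBipartite)
    (hW : IsIrreducibleTModule G x W) (hthin : IsThin G x W) {r : ℕ} (hr : r + 1 ≤ G.diam)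
    (hend : endpoint G x W = r + 1) {v : X → ℂ} (hv : v ∈ dualComponent G x (r + 1) W)
    (hv0 : v ≠ 0) : W = boseMesnerSpan G v := by
  obtain ⟨hT, -, hirr⟩ := hW
  set u := raise G x (r + 1) v with hu
  have hu0 : u 0 = v := rfl
  have hus : ∀ i, u (i + 1) = dualIdempotent G x (r + 1 + i + 1) *ᵥ (adjacency G *ᵥ u i) :=
    fun i => rfl
  have hmem : ∀ i, u i ∈ dualComponent G x (r + 1 + i) W := by
    intro i
    induction i with
    | zero => exact hv
    | succ i ih =>
      exact ⟨_, hT.adjacency_mulVec_mem (hT.mem_dualComponent.1 ih).1, rfl⟩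
  have hE : ∀ i, dualIdempotent G x (r + 1 + i) *ᵥ u i = u i :=
    fun i => (hT.mem_dualComponent.1 (hmem i)).2
  have hAu : ∀ i, adjacency G *ᵥ u i = u (i + 1) +
      dualIdempotent G x (r + i) *ᵥ (adjacency G *ᵥ u i) := by
    intro i
    have h := hE i
    rw [show r + 1 + i = r + i + 1 by omega] at h
    have h' := adjacency_mulVec_eq_add hG.1 hbip h
    rw [hus, show r + 1 + i + 1 = r + i + 2 by omega]
    exact h'
  have hlow : ∀ i, dualIdempotent G x (r + i) *ᵥ (adjacency G *ᵥ u i) ∈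
      dualComponent G x (r + i) W := fun i =>
    ⟨_, hT.adjacency_mulVec_mem (hT.mem_dualComponent.1 (hmem i)).1, rfl⟩
  have hA0 : adjacency G *ᵥ u 0 = u 1 := by
    have h := hlow 0
    rw [dualComponent_eq_bot_of_lt_endpoint (by omega) (by omega), Submodule.mem_bot] at h
    rw [hAu 0, h, add_zero]
  -- By thinness the lowered part of `A u (i + 1)` is a multiple of `u i` when `u i ≠ 0`; when `u i
  -- = 0`, all later vectors vanish too.
  have hA : ∀ i, ∃ a : ℂ, adjacency G *ᵥ u (i + 1) = u (i + 2) + a • u i := by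
    intro i
    by_cases h0 : u i = 0
    · refine ⟨0, ?_⟩
      rw [hus (i + 1), hus i, h0]; simp
    · have hle : r + 1 + i ≤ G.diam := by
        by_contra! hlt
        apply h0
        rw [← hE i]
        ext y
        rw [dualIdempotent_mulVec_apply, if_neg, Pi.zero_apply]
        exact ((hG.dist_le_diam x y).trans_lt hlt).ne
      have h := hlow (i + 1)
      rw [show r + (i + 1) = r + 1 + i by omega] at h
      obtain ⟨a, ha⟩ := hthin.exists_smul_eq hle (hmem i) h0 h
      exact ⟨a, (hAu (i + 1)).trans (by rw [show r + (i + 1) = r + 1 + i by omega, ha])⟩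
  have huM : ∀ i, u i ∈ boseMesnerSpan G v ∧ u (i + 1) ∈ boseMesnerSpan G v := by
    intro i
    induction i with
    | zero =>
      refine ⟨self_mem_boseMesnerSpan v, ?_⟩
      rw [zero_add, ← hA0]
      exact adjacency_mulVec_mem_boseMesnerSpan (self_mem_boseMesnerSpan v)
    | succ i ih =>
      refine ⟨ih.2, ?_⟩
      obtain ⟨a, ha⟩ := hA i
      -- The recurrence solved for its top vector; membership in `Mv` is carried for two consecutive
      -- indices for this reason.
      rw [eq_sub_of_add_eq ha.symm]
      exact Submodule.sub_mem _ (adjacency_mulVec_mem_boseMesnerSpan ih.2)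
        (Submodule.smul_mem _ a ih.1)
  have hspan : ∀ i, u i ∈ Submodule.span ℂ (Set.range u) := fun i =>
    Submodule.subset_span ⟨i, rfl⟩
  have hS : IsTModule G x (Submodule.span ℂ (Set.range u)) := by
    refine isTModule_of_generators ?_ fun j => ?_
    · suffices h : Submodule.span ℂ (Set.range u) ≤
          (Submodule.span ℂ (Set.range u)).comap (adjacency G).mulVecLin from h
      rw [Submodule.span_le]
      rintro _ ⟨i, rfl⟩
      rw [SetLike.mem_coe, Submodule.mem_comap, Matrix.mulVecLin_apply]
      cases i with
      | zero => rw [hA0]; exact hspan 1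
      | succ i =>
        obtain ⟨a, ha⟩ := hA i
        rw [ha]
        exact Submodule.add_mem _ (hspan _) (Submodule.smul_mem _ a (hspan _))
    · suffices h : Submodule.span ℂ (Set.range u) ≤
          (Submodule.span ℂ (Set.range u)).comap (dualIdempotent G x j).mulVecLin from h
      rw [Submodule.span_le]
      rintro _ ⟨i, rfl⟩
      rw [SetLike.mem_coe, Submodule.mem_comap, Matrix.mulVecLin_apply]
      rw [← hE i, dualIdempotent_mulVec_dualIdempotent_mulVec]
      split_ifs
      · rw [hE i]; exact hspan i
      · exact Submodule.zero_mem _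
  have hSW : Submodule.span ℂ (Set.range u) ≤ W := by
    rw [Submodule.span_le]
    rintro _ ⟨i, rfl⟩
    exact (hT.mem_dualComponent.1 (hmem i)).1
  refine le_antisymm ?_ (hT.boseMesnerSpan_le (hT.mem_dualComponent.1 hv).1)
  rcases hirr _ hS hSW with h | h
  · have := hspan 0
    rw [h, Submodule.mem_bot, hu0] at this
    exact absurd this hv0
  · rw [← h, Submodule.span_le]
    rintro _ ⟨i, rfl⟩
    exact (huM i).1

end Modules

/-! ### Vanishing of the projections in terms of the local eigenvalue -/

section LocalEigenvalue

variable {X : Type*} [Fintype X] [DecidableEq X] {G : SimpleGraph X} {x : X}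
  {W : Submodule ℂ (X → ℂ)}

/-- Endpoint 2 means that `A v` vanishes on the neighbours of `x`. Summing these entries counts each
vertex at distance 2 from `x` exactly `c_2 > 0` times. -/
theorem sum_eq_zero_of_mem_dualComponent (hG : IsDistanceRegular G) (hD : 2 ≤ G.diam)
    (hT : IsTModule G x W) (hend : endpoint G x W = 2) {v : X → ℂ}
    (hv : v ∈ dualComponent G x 2 W) : ∑ z, v z = 0 := by
  obtain ⟨hvW, hv2⟩ := hT.mem_dualComponent.1 hv
  have h1 : dualIdempotent G x 1 *ᵥ (adjacency G *ᵥ v) = 0 := by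
    have : dualIdempotent G x 1 *ᵥ (adjacency G *ᵥ v) ∈ dualComponent G x 1 W :=
      ⟨_, hT.adjacency_mulVec_mem hvW, rfl⟩
    rwa [dualComponent_eq_bot_of_lt_endpoint (by omega) (by omega), Submodule.mem_bot] at this
  have h2 : ∑ y with G.dist x y = 1, ∑ z with G.dist y z = 1, v z = 0 := by
    refine Finset.sum_eq_zero fun y hy => ?_
    have := congrFun h1 y
    rwa [dualIdempotent_mulVec_apply, if_pos (Finset.mem_filter.1 hy).2,
      adjacency_mulVec_apply] at this
  have h3 : ∑ y with G.dist x y = 1, ∑ z with G.dist y z = 1, v z =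
      ∑ z, (c G 2 : ℂ) * v z := by
    rw [Finset.sum_congr rfl fun y _ => Finset.sum_filter (fun z => G.dist y z = 1) v,
      Finset.sum_comm]
    refine Finset.sum_congr rfl fun z _ => ?_
    rw [← Finset.sum_filter, Finset.filter_filter, Finset.sum_const, nsmul_eq_mul]
    by_cases hz : G.dist x z = 2
    · rw [hG.card_eq (by omega) (by omega) hz, c]
    · rw [← hv2, dualIdempotent_mulVec_apply, if_neg hz, mul_zero, mul_zero]
  rw [h3, ← Finset.mul_sum, mul_eq_zero] at h2
  exact h2.resolve_left (by exact_mod_cast (hG.c_pos (j := 1) (by omega)).ne')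

/-- The second component of a module with endpoint `2` is an eigenspace of `E*_2 E E*_2` for each
primitive idempotent `E`. -/
theorem eigenprojection_mulVec_apply (hG : IsDistanceRegular G) (hbip : G.IsBipartite)
    (hD : 2 ≤ G.diam) (hT : IsTModule G x W) (hend : endpoint G x W = 2) {η : ℝ}
    (hloc : HasLocalEigenvalue G x W η) {v : X → ℂ} (hv : v ∈ dualComponent G x 2 W)
    {t : ℝ} {f : ℕ → ℂ} (hf : ∀ y z, eigenprojection G t y z = f (G.dist y z)) {y : X}
    (hy : G.dist x y = 2) :
    (eigenprojection G t *ᵥ v) y = (f 0 - f 4 + η * (f 2 - f 4)) * v y := by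
  obtain ⟨hvW, hv2⟩ := hT.mem_dualComponent.1 hv
  have hsum := sum_eq_zero_of_mem_dualComponent hG hD hT hend hv
  have hA2 : ∑ z, (if G.dist y z = 2 then v z else 0) = η * v y := by
    have h := congrFun (hloc.2 v hv) y
    rw [← Matrix.mulVec_mulVec, ← Matrix.mulVec_mulVec, hv2, dualIdempotent_mulVec_apply,
      if_pos hy] at h
    simpa [Matrix.mulVec, dotProduct, distMatrix] using h
  -- On the support of `v` the distance to `y` is 0, 2 or 4. Subtracting the constant `f 4` removes
  -- the unknown sum at distance 4, since `v` sums to 0.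
  have hterm : ∀ z, f (G.dist y z) * v z = (f 0 - f 4) * (if z = y then v z else 0) +
      (f 2 - f 4) * (if G.dist y z = 2 then v z else 0) + f 4 * v z := by
    intro z
    by_cases hz : G.dist x z = 2
    · have hle : G.dist y z ≤ G.dist y x + G.dist x z := hG.1.dist_triangle
      rw [G.dist_comm (u := y) (v := x), hy, hz] at hle
      have heven := even_dist_of_dist_eq hG.1 hbip (hy.trans hz.symm)
      have h0 : z = y ↔ G.dist y z = 0 := by rw [hG.1.dist_eq_zero_iff, eq_comm]
      simp only [h0]
      generalize G.dist y z = m at *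
      have : m = 0 ∨ m = 2 ∨ m = 4 := by
        obtain ⟨l, rfl⟩ := heven
        omega
      rcases this with rfl | rfl | rfl <;> simp <;> ring
    · have : v z = 0 := by rw [← hv2, dualIdempotent_mulVec_apply, if_neg hz]
      simp [this]
  have : (eigenprojection G t *ᵥ v) y = ∑ z, f (G.dist y z) * v z := by
    simp [Matrix.mulVec, dotProduct, hf]
  rw [this, Finset.sum_congr rfl fun z _ => hterm z, Finset.sum_add_distrib,
    Finset.sum_add_distrib, ← Finset.mul_sum, ← Finset.mul_sum, ← Finset.mul_sum, hA2, hsum,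
    Finset.sum_ite_eq' Finset.univ y v, if_pos (Finset.mem_univ _)]
  ring

theorem eigenprojection_mulVec_eq_zero_iff [DecidableRel G.Adj] (hG : IsDistanceRegular G)
    (hbip : G.IsBipartite) (hD : 4 ≤ G.diam) {k : ℕ} (hreg : G.IsRegularOfDegree k)
    (hk : 2 ≤ k) (hT : IsTModule G x W) (hend : endpoint G x W = 2) {s : ℝ}
    (hs : s ^ 2 ≠ b G 2) (hloc : HasLocalEigenvalue G x W (tilde G s)) {v : X → ℂ}
    (hv : v ∈ dualComponent G x 2 W) (hv0 : v ≠ 0) {t : ℝ} (ht : t ∈ eigenvalueSet G) :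
    eigenprojection G t *ᵥ v = 0 ↔ t ^ 2 = (k : ℝ) ^ 2 ∨ t ^ 2 = s ^ 2 := by
  obtain ⟨f, r, hr, hf0, hf, h1, h2⟩ := exists_profile_recurrence hG hbip hD hreg ht
  obtain ⟨hvW, hv2⟩ := hT.mem_dualComponent.1 hv
  have hv2' : ∀ y, G.dist x y ≠ 2 → v y = 0 := fun y hy => by
    rw [← hv2, dualIdempotent_mulVec_apply, if_neg hy]
  have happ := fun y (hy : G.dist x y = 2) =>
    eigenprojection_mulVec_apply hG hbip (by omega) hT hend hloc hv hf hy
  have hs' : (s : ℂ) ^ 2 - b G 2 ≠ 0 := by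
    rw [sub_ne_zero]; exact_mod_cast hs
  have hb2 : (b G 2 : ℂ) ≠ 0 := by exact_mod_cast (hG.b_pos (j := 2) (by omega)).ne'
  have hb3 : (b G 3 : ℂ) ≠ 0 := by exact_mod_cast (hG.b_pos (j := 3) (by omega)).ne'
  have hk0 : (k : ℂ) * (k - 1) ≠ 0 := by
    refine mul_ne_zero (by exact_mod_cast (by omega : k ≠ 0)) (sub_ne_zero.2 ?_)
    exact_mod_cast (by omega : k ≠ 1)
  set l := f 0 - f 4 + (tilde G s : ℂ) * (f 2 - f 4) with hl
  have hη : ((tilde G s : ℝ) : ℂ) * (s ^ 2 - b G 2) = -(s ^ 2 - b G 2) - b G 2 * b G 3 := by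
    rw [tilde]; push_cast; field_simp
  -- Write `l = (f 0 - f 2) + (1 + η)(f 2 - f 4)` with `1 + η = -b_2 b_3 / (s² - b_2)`. The common
  -- factor `k² - t²` comes out, leaving `(s² - b_2) - (t² - b_2)`.
  have hlam : (k : ℂ) * (k - 1) * (s ^ 2 - b G 2) * l =
      (k ^ 2 - t ^ 2) * (s ^ 2 - t ^ 2) * r := by
    rw [hl]
    linear_combination (s ^ 2 - b G 2 : ℂ) * h1 - h2 + (k : ℂ) * (k - 1) * (f 2 - f 4) * hη
  have hl0 : l = 0 ↔ t ^ 2 = (k : ℝ) ^ 2 ∨ t ^ 2 = s ^ 2 := by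
    rw [← mul_right_inj' (mul_ne_zero hk0 hs'), mul_zero, hlam, mul_eq_zero, mul_eq_zero,
      sub_eq_zero, sub_eq_zero, or_iff_left (by exact_mod_cast hr.ne')]
    norm_cast
    rw [eq_comm, eq_comm (a := s ^ 2)]
  rw [← hl0]
  constructor
  · intro h
    obtain ⟨y, hy⟩ := Function.ne_iff.1 hv0
    have hxy : G.dist x y = 2 := by
      by_contra hne
      exact hy (hv2' y hne)
    have := happ y hxy
    rw [h, Pi.zero_apply, eq_comm, mul_eq_zero] at this
    exact this.resolve_right hy
  · intro h
    -- The scalar controls `E v` only at distance 2 from `x`, but that is the support of `v`, so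
    -- `⟨v, E v⟩ = 0`.
    apply eigenprojection_mulVec_eq_zero_of_orthogonal
    refine Finset.sum_eq_zero fun y _ => ?_
    by_cases hxy : G.dist x y = 2
    · rw [happ y hxy, h, zero_mul, mul_zero]
    · rw [Pi.star_apply, hv2' y hxy, star_zero, zero_mul]

end LocalEigenvalue

end DRG

/-! ### The main theorem -/

theorem mainTheorem6 {X : Type*} [Fintype X] [DecidableEq X] (G : SimpleGraph X)
    [DecidableRel G.Adj] (hG : DRG.IsDistanceRegular G) (hbip : G.IsBipartite)
    (hD : 4 ≤ G.diam) (k : ℕ) (hreg : G.IsRegularOfDegree k) (hk : 3 ≤ k) (x : X)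
    (n : ℕ) (hn : (Odd G.diam ∧ (n = 1 ∨ n = G.diam / 2)) ∨ (Even G.diam ∧ n = 1))
    (W : Submodule ℂ (X → ℂ)) (hW : DRG.IsIrreducibleTModule G x W)
    (hthin : DRG.IsThin G x W) (hend : DRG.endpoint G x W = 2)
    (hloc : DRG.HasLocalEigenvalue G x W (DRG.tilde G (DRG.eigenvalue G n)))
    (v : X → ℂ) (hv : v ∈ DRG.dualComponent G x 2 W) (hv0 : v ≠ 0) :
    W = DRG.boseMesnerSpan G v ∧
    LinearIndependent ℂ
      (fun i : {i : ℕ // 1 ≤ i ∧ i ≤ G.diam - 1 ∧ i ≠ n ∧ i ≠ G.diam - n} =>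
        DRG.primitiveIdempotent G i *ᵥ v) ∧
    Submodule.span ℂ (Set.range
      (fun i : {i : ℕ // 1 ≤ i ∧ i ≤ G.diam - 1 ∧ i ≠ n ∧ i ≠ G.diam - n} =>
        DRG.primitiveIdempotent G i *ᵥ v)) = W ∧
    DRG.primitiveIdempotent G 0 *ᵥ v = 0 ∧
    DRG.primitiveIdempotent G n *ᵥ v = 0 ∧
    DRG.primitiveIdempotent G (G.diam - n) *ᵥ v = 0 ∧
    DRG.primitiveIdempotent G G.diam *ᵥ v = 0 := by
  obtain ⟨hn0, hnD, hnn, hs⟩ : 0 < n ∧ n < G.diam ∧ n ≠ G.diam - n ∧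
      DRG.eigenvalue G n ^ 2 ≠ DRG.b G 2 := by
    have h1 := (DRG.b_two_lt_eigenvalue_one_sq hG hbip hD hreg).ne'
    rcases hn with ⟨hodd, rfl | rfl⟩ | ⟨-, rfl⟩
    · exact ⟨by omega, by omega, by omega, h1⟩
    · exact ⟨by omega, by omega, by obtain ⟨d, hd⟩ := hodd; omega,
        (DRG.eigenvalue_half_sq_lt_b_two hG hbip hD hreg hodd).ne⟩
    · exact ⟨by omega, by omega, by omega, h1⟩
  have hD1 : 1 ≤ G.diam := by omega
  have hWv : W = DRG.boseMesnerSpan G v :=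
    DRG.eq_boseMesnerSpan hG hbip hW hthin (by omega) hend hv hv0
  have hzero : ∀ i ≤ G.diam, DRG.primitiveIdempotent G i *ᵥ v = 0 ↔
      i = 0 ∨ i = G.diam ∨ i = n ∨ i = G.diam - n := by
    intro i hi
    change DRG.eigenprojection G (DRG.eigenvalue G i) *ᵥ v = 0 ↔ _
    rw [DRG.eigenprojection_mulVec_eq_zero_iff hG hbip hD hreg (by omega) hW.1 hend hs hloc hv hv0
      (DRG.eigenvalue_mem hG hD1 hi), ← DRG.eigenvalue_zero hG hD1 hreg,
      DRG.eigenvalue_sq_eq_iff hG hD1 hbip hi (Nat.zero_le _),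
      DRG.eigenvalue_sq_eq_iff hG hD1 hbip hi hnD.le, Nat.sub_zero, or_assoc]
  refine ⟨hWv, ?_, ?_, (hzero _ (by omega)).2 (by omega), (hzero _ (by omega)).2 (by omega),
    (hzero _ (by omega)).2 (by omega), (hzero _ (by omega)).2 (by omega)⟩
  · refine Module.End.eigenvectors_linearIndependent' (Matrix.toLin' (DRG.adjacency G))
      (fun i : {i : ℕ // 1 ≤ i ∧ i ≤ G.diam - 1 ∧ i ≠ n ∧ i ≠ G.diam - n} =>
        ((DRG.eigenvalue G i : ℝ) : ℂ)) ?_ _ fun i => ⟨?_, ?_⟩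
    · rintro ⟨i, hi⟩ ⟨j, hj⟩ hij
      exact Subtype.ext ((DRG.eigenvalue_inj hG hD1 (show i ≤ G.diam by omega)
        (show j ≤ G.diam by omega)).1 (Complex.ofReal_injective hij))
    · rw [Module.End.mem_eigenspace_iff, Matrix.toLin'_apply]
      exact DRG.adjacency_mulVec_eigenprojection_mulVec _ _
    · obtain ⟨i, hi⟩ := i
      rw [Ne, hzero i (by omega)]
      omega
  · rw [hWv, DRG.boseMesnerSpan_eq_span]
    apply le_antisymm
    · refine Submodule.span_mono ?_
      rintro _ ⟨⟨i, hi⟩, rfl⟩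
      exact ⟨_, DRG.eigenvalue_mem hG hD1 (show i ≤ G.diam by omega), rfl⟩
    · rw [Submodule.span_le]
      rintro _ ⟨t, ht, rfl⟩
      obtain ⟨i, hi, rfl⟩ := DRG.exists_eigenvalue_eq hG hD1 ht
      change DRG.primitiveIdempotent G i *ᵥ v ∈ _
      -- All the projections of `v` span `Mv`; those outside the index set are zero and can be
      -- dropped.
      by_cases h : DRG.primitiveIdempotent G i *ᵥ v = 0
      · rw [h]; exact Submodule.zero_mem _
      · rw [hzero i hi] at h
        exact Submodule.subset_span ⟨⟨i, by omega⟩, rfl⟩
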